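/- There is an absolute constant $C>0$ such that the following holds. Let $m,B,k\ge 1$ and $d\ge 0$ be integers, let $A\in\mathbb{C}^{mB\times d}$ be a matrix with rows $a_1,\dots,a_{mB}$, and for $b\in\{1,\dots,m\}$ let $A_b\in\mathbb{C}^{B\times d}$ be the matrix with rows $a_{B(b-1)+1},\dots,a_{Bb}$. Put $\|x\|_X=\max_{1\le b\le m}\|A_bx\|_2$ for $x\in\mathbb{C}^d$, and let $T_s$ denote the set of vectors $x\in\mathbb{C}^d$ with at most $s$ non-zero entries and $\|x\|_2\le 1$. Suppose that there are a function $\ell$ and real numbers $Q_1,Q_2$ such that \[ \max_{1\le b\le m}\ \sup_{x\in T_s}\|A_bx\|_2\le \ell(s)\quad\text{and}\quad \ell(s)\le Q_1\sqrt{B}+Q_2\sqrt{s}\qquad\text{for all integers } 1\le s\le 2k, \] that all entries of $A$ have absolute value at most $1$, and that \[ B\ge\max\{Q_2^2\log^2 m,\ Q_1^2\log m\,\log k\}\qquad\text{and}\qquad k\ge Q_1^2\log^2 m . \] Then for every $u>0$, \[ \mathcal{N}\bigl(T_k/\sqrt{k},\,\|\cdot\|_X,\,u\bigr)\le (2d+1)^{C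 B/u^2}, \] where $\mathcal{N}(T,\|\cdot\|_X,u)$ is the least cardinality of a set $N\subseteq T$ such that every $x\in T$ has some $y\in N$ with $\|x-y\|_X\le u$. -/

import Mathlib

open scoped NNReal ENNReal

noncomputable section

/-- The set `T_k` of `k`-sparse vectors of `ℂ^d` with Euclidean norm at most `1`.
`hammingNorm` is the number of nonzero coordinates. -/
def sparseBall (d k : ℕ) : Set (EuclideanSpace ℂ (Fin d)) :=
  {x | hammingNorm (x.ofLp : Fin d → ℂ) ≤ k ∧ ‖x‖ ≤ 1}

/-- The scaled set `T_k / √k`. -/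
def scaledSparseBall (d k : ℕ) : Set (EuclideanSpace ℂ (Fin d)) :=
  (fun x => (Real.sqrt k)⁻¹ • x) '' sparseBall d k

/-- The `b`-th bucket `A_b` of an `mB × d` matrix `A`: the `B × d` matrix of the `B` consecutive
rows of `A` with (zero-based) indices `B * b + i`, `i < B`. -/
def bucket {m B d : ℕ} (A : Matrix (Fin (m * B)) (Fin d) ℂ) (b : Fin m) :
    Matrix (Fin B) (Fin d) ℂ :=
  Matrix.of fun i j => A (finProdFinEquiv (b, i)) j

/-- The seminorm `x ↦ ‖A_b x‖₂` on `ℂ^d`. -/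
def bucketSeminorm {m B d : ℕ} (A : Matrix (Fin (m * B)) (Fin d) ℂ) (b : Fin m) :
    Seminorm ℂ (EuclideanSpace ℂ (Fin d)) :=
  (normSeminorm ℂ (EuclideanSpace ℂ (Fin B))).comp (Matrix.toEuclideanLin (bucket A b))

/-- The norm `‖x‖_X = max_b ‖A_b x‖₂` (in general only a seminorm). -/
def xSeminorm {m B d : ℕ} (A : Matrix (Fin (m * B)) (Fin d) ℂ) :
    Seminorm ℂ (EuclideanSpace ℂ (Fin d)) :=
  Finset.univ.sup (bucketSeminorm A)

/-- `‖x‖_X` is the maximum over the buckets of `‖A_b x‖₂`. -/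
theorem xSeminorm_apply {m B d : ℕ} (A : Matrix (Fin (m * B)) (Fin d) ℂ)
    (x : EuclideanSpace ℂ (Fin d)) :
    xSeminorm A x = ⨆ b : Fin m, ‖Matrix.toEuclideanLin (bucket A b) x‖ := by
  apply le_antisymm
  · refine Seminorm.finset_sup_apply_le (Real.iSup_nonneg fun _ => norm_nonneg _) fun b _ => ?_
    exact le_ciSup (f := fun b : Fin m => ‖Matrix.toEuclideanLin (bucket A b) x‖)
      (Set.finite_range _).bddAbove b
  · refine Real.iSup_le (fun b => ?_) (apply_nonneg _ _)
    exact Seminorm.le_finset_sup_apply (p := bucketSeminorm A) (Finset.mem_univ b)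

/-- The covering number `N(T, p, u)`: the least cardinality of a `u`-net of `T`, that is, of a
subset of `T` such that every point of `T` is within `p`-distance at most `u` of it. -/
def seminormCoveringNumber {E : Type*} [AddCommGroup E] [Module ℂ E]
    (T : Set E) (p : Seminorm ℂ E) (u : ℝ≥0) : ℕ∞ :=
  letI : SeminormedAddCommGroup E := p.toAddGroupSeminorm.toSeminormedAddCommGroup
  Metric.coveringNumber u T

/-- The event that `max_b sup_{x ∈ T_s} ‖A_b x‖₂ ≤ ℓ(s)` for all `s ∈ {1, …, 2k}`. -/
def GoodBuckets {m B d : ℕ} (A : Matrix (Fin (m * B)) (Fin d) ℂ) (k : ℕ) (l : ℕ → ℝ) : Prop :=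
  ∀ s : ℕ, 1 ≤ s → s ≤ 2 * k → ∀ b : Fin m, ∀ x ∈ sparseBall d s,
    ‖Matrix.toEuclideanLin (bucket A b) x‖ ≤ l s

end

noncomputable section

/-! This is Maurey's empirical method with a Bernstein bound in place of a plain variance bound. A
point `x` of `T_k / √k` has ℓ¹ norm at most `1`, so it is a mean of the `4d+1` atoms `0`, `2ωe_j`.
Averages of `L ≍ B/u²` atoms number at most `(4d+1)^L`, so it suffices that some average lies within
`u/2` of `x` in all buckets at once.

A union bound over `m` buckets would normally cost a factor depending on `log m`. Here only the weak
variance, in one direction `S`, gets multiplied by it. That variance is at most `4Rτ‖S‖²`, with `R =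
√B` bounding the columns and `τ` bounding `‖A_b y‖` over all `y` with the moduli of `x`. The
hypotheses give `τ ≤ 2√B / log m`, which cancels the loss. `exists_norm_sum_le` is the Bernstein
bound, `sum_norm_mul_norm_inner_sq_le` the variance bound, and `exists_norm_map_sub_average_le`
combines them. -/

theorem sqrt_sq_add_le {a y : ℝ} (ha : 0 < a) (h : 0 ≤ a ^ 2 + y) :
    Real.sqrt (a ^ 2 + y) ≤ a + y / (2 * a) := by
  have e : a + y / (2 * a) = (2 * a ^ 2 + y) / (2 * a) := by field_simp
  have h0 : 0 ≤ a + y / (2 * a) := by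
    rw [e]; apply div_nonneg <;> nlinarith [sq_nonneg a]
  apply Real.sqrt_le_iff.2 ⟨h0, ?_⟩
  have : (a + y / (2 * a)) ^ 2 = a ^ 2 + y + (y / (2 * a)) ^ 2 := by
    field_simp; ring
  nlinarith [sq_nonneg (y / (2 * a))]

theorem Real.exp_le_one_add_add_sq {t : ℝ} (ht : |t| ≤ 1) : Real.exp t ≤ 1 + t + t ^ 2 := by
  have := (abs_le.1 (Real.abs_exp_sub_one_sub_id_le ht)).2
  linarith

/-! ### Exponential moments of sums of centred vectors in a Hilbert space. -/

section Greedy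

theorem re_inner_real_smul {H : Type*} [NormedAddCommGroup H] [InnerProductSpace ℂ H] (S v : H)
    (a : ℝ) : (inner ℂ S (a • v)).re = a * (inner ℂ S v).re := by
  rw [← Complex.coe_smul, inner_smul_right, Complex.re_ofReal_mul]

variable {ι β H : Type*} [Fintype ι] [Fintype β] [NormedAddCommGroup H] [InnerProductSpace ℂ H]

/-- One step of a random walk with centred bounded increments: the exponential moment of the
regularised norm grows by a factor governed by the weak variance of the increments. -/
theorem sum_mul_exp_sqrt_norm_add_le {p : ι → ℝ} (hp : ∀ j, 0 ≤ p j) (hsum : ∑ j, p j = 1)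
    {v : ι → H} (hmean : ∑ j, p j • v j = 0) {M V r c : ℝ} (hM : ∀ j, ‖v j‖ ≤ M)
    (hV : ∀ S : H, ∑ j, p j * (inner ℂ S (v j)).re ^ 2 ≤ V * ‖S‖ ^ 2) (hV0 : 0 ≤ V)
    (hr : 0 < r) (hc : 0 ≤ c) (hcM : c * M ≤ 1) (S : H) :
    ∑ j, p j * Real.exp (c * Real.sqrt (r ^ 2 + ‖S + v j‖ ^ 2)) ≤
      Real.exp (c * (M ^ 2 / (2 * r)) + c ^ 2 * V) *
        Real.exp (c * Real.sqrt (r ^ 2 + ‖S‖ ^ 2)) := by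
  set a := Real.sqrt (r ^ 2 + ‖S‖ ^ 2) with ha
  have hra : r ≤ a := Real.le_sqrt_of_sq_le (by nlinarith [sq_nonneg ‖S‖])
  have hSa : ‖S‖ ≤ a := Real.le_sqrt_of_sq_le (by nlinarith [sq_nonneg r])
  have ha0 : 0 < a := hr.trans_le hra
  have hasq : a ^ 2 = r ^ 2 + ‖S‖ ^ 2 := Real.sq_sqrt (by positivity)
  -- The first-order change of the exponent: it has mean zero, so only its square matters. Smoothing
  -- the norm at scale `r` bounds the rest by `c * (M ^ 2 / (2 * r))`.
  set t : ι → ℝ := fun j => c * ((inner ℂ S (v j)).re / a) with ht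
  have ht1 : ∀ j, |t j| ≤ 1 := by
    intro j
    have h1 : |(inner ℂ S (v j)).re| ≤ a * M :=
      ((Complex.abs_re_le_norm _).trans (norm_inner_le_norm _ _)).trans
        (mul_le_mul hSa (hM j) (norm_nonneg _) ha0.le)
    have h2 : |(inner ℂ S (v j)).re / a| ≤ M := by
      rw [abs_div, abs_of_pos ha0, div_le_iff₀ ha0]; linarith
    rw [ht]
    simp only
    rw [abs_mul, abs_of_nonneg hc]
    exact (mul_le_mul_of_nonneg_left h2 hc).trans hcM
  have hstep : ∀ j, Real.exp (c * Real.sqrt (r ^ 2 + ‖S + v j‖ ^ 2)) ≤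
      Real.exp (c * a) * Real.exp (c * (M ^ 2 / (2 * r))) * (1 + t j + t j ^ 2) := by
    intro j
    have h1 : r ^ 2 + ‖S + v j‖ ^ 2 = a ^ 2 + (2 * (inner ℂ S (v j)).re + ‖v j‖ ^ 2) := by
      rw [hasq, norm_add_sq (𝕜 := ℂ), RCLike.re_eq_complex_re]; ring
    have h2 : Real.sqrt (r ^ 2 + ‖S + v j‖ ^ 2) ≤
        a + (inner ℂ S (v j)).re / a + M ^ 2 / (2 * r) := by
      have h3 := sqrt_sq_add_le ha0 (y := 2 * (inner ℂ S (v j)).re + ‖v j‖ ^ 2)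
        (by rw [← h1]; positivity)
      rw [← h1] at h3
      have h4 : (2 * (inner ℂ S (v j)).re + ‖v j‖ ^ 2) / (2 * a) =
          (inner ℂ S (v j)).re / a + ‖v j‖ ^ 2 / (2 * a) := by field_simp
      have h5 : ‖v j‖ ^ 2 / (2 * a) ≤ M ^ 2 / (2 * r) := by
        gcongr
        exact hM j
      linarith
    have h3 : c * Real.sqrt (r ^ 2 + ‖S + v j‖ ^ 2) ≤ c * a + c * (M ^ 2 / (2 * r)) + t j := by
      have := mul_le_mul_of_nonneg_left h2 hc
      simp only [ht]
      linarith
    calc _ ≤ Real.exp (c * a + c * (M ^ 2 / (2 * r)) + t j) := Real.exp_le_exp.2 h3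
      _ = Real.exp (c * a) * Real.exp (c * (M ^ 2 / (2 * r))) * Real.exp (t j) := by
        rw [Real.exp_add, Real.exp_add]
      _ ≤ _ := by
        gcongr
        exact Real.exp_le_one_add_add_sq (ht1 j)
  have hmean' : ∑ j, p j * t j = 0 := by
    have : ∑ j, p j * t j = c / a * (inner ℂ S (∑ j, p j • v j)).re := by
      rw [inner_sum, Complex.re_sum, Finset.mul_sum]
      refine Finset.sum_congr rfl fun j _ => ?_
      rw [re_inner_real_smul]; simp only [ht]; ring
    rw [this, hmean, inner_zero_right, Complex.zero_re, mul_zero]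
  have hvar : ∑ j, p j * t j ^ 2 ≤ c ^ 2 * V := by
    have h1 : ∑ j, p j * t j ^ 2 = c ^ 2 / a ^ 2 * ∑ j, p j * (inner ℂ S (v j)).re ^ 2 := by
      rw [Finset.mul_sum]
      refine Finset.sum_congr rfl fun j _ => ?_
      simp only [ht]; ring
    have h2 : V * ‖S‖ ^ 2 ≤ V * a ^ 2 := by gcongr
    rw [h1]
    calc _ ≤ c ^ 2 / a ^ 2 * (V * a ^ 2) := by
          gcongr
          exact (hV S).trans h2
      _ = c ^ 2 * V := by field_simp
  have hfac : ∑ j, p j * (1 + t j + t j ^ 2) ≤ Real.exp (c ^ 2 * V) := by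
    have : ∑ j, p j * (1 + t j + t j ^ 2) = 1 + 0 + ∑ j, p j * t j ^ 2 := by
      simp only [mul_add, mul_one, Finset.sum_add_distrib, hsum, hmean']
    rw [this]
    have := Real.add_one_le_exp (c ^ 2 * V)
    linarith
  calc _ ≤ ∑ j, p j * (Real.exp (c * a) * Real.exp (c * (M ^ 2 / (2 * r))) *
        (1 + t j + t j ^ 2)) :=
        Finset.sum_le_sum fun j _ => mul_le_mul_of_nonneg_left (hstep j) (hp j)
    _ = Real.exp (c * a) * Real.exp (c * (M ^ 2 / (2 * r))) *
        ∑ j, p j * (1 + t j + t j ^ 2) := by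
      rw [Finset.mul_sum]
      exact Finset.sum_congr rfl fun j _ => by ring
    _ ≤ Real.exp (c * a) * Real.exp (c * (M ^ 2 / (2 * r))) * Real.exp (c ^ 2 * V) := by
      gcongr
    _ = _ := by rw [Real.exp_add]; ring

theorem exists_le_sum_mul {p f : ι → ℝ} (hp : ∀ j, 0 ≤ p j) (hsum : ∑ j, p j = 1) :
    ∃ j, f j ≤ ∑ i, p i * f i := by
  by_contra! h
  have hne : ∃ j, p j ≠ 0 := by
    by_contra! h0
    simp [h0] at hsum
  obtain ⟨j, hj⟩ := hne
  have : ∑ i, p i * (∑ i, p i * f i) < ∑ i, p i * f i :=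
    Finset.sum_lt_sum (fun i _ => mul_le_mul_of_nonneg_left (h i).le (hp i))
      ⟨j, Finset.mem_univ _, mul_lt_mul_of_pos_left (h j) ((hp j).lt_of_ne' hj)⟩
  rw [← Finset.sum_mul, hsum, one_mul] at this
  exact lt_irrefl _ this

/-- Derandomised Bernstein inequality, simultaneously for finitely many families of centred
bounded vectors of a Hilbert space. -/
theorem exists_norm_sum_le [Nonempty β] {p : ι → ℝ} (hp : ∀ j, 0 ≤ p j)
    (hsum : ∑ j, p j = 1) {v : β → ι → H} (hmean : ∀ b, ∑ j, p j • v b j = 0) {M V r c : ℝ}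
    (hM : ∀ b j, ‖v b j‖ ≤ M)
    (hV : ∀ b, ∀ S : H, ∑ j, p j * (inner ℂ S (v b j)).re ^ 2 ≤ V * ‖S‖ ^ 2) (hV0 : 0 ≤ V)
    (hr : 0 < r) (hc : 0 < c) (hcM : c * M ≤ 1) (L : ℕ) :
    ∃ z : Fin L → ι, ∀ b, ‖∑ i, v b (z i)‖ ≤
      Real.log (Fintype.card β) / c + r + L * (M ^ 2 / (2 * r) + c * V) := by
  set δ := c * (M ^ 2 / (2 * r)) + c ^ 2 * V with hδ
  -- Greedy choice: each new index keeps the potential, summed over all `b`, at most its mean.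
  -- Summing over `b` plays the part of the union bound.
  have key : ∃ z : Fin L → ι,
      ∑ b, Real.exp (c * Real.sqrt (r ^ 2 + ‖∑ i, v b (z i)‖ ^ 2)) ≤
        Real.exp (L * δ) * (Fintype.card β * Real.exp (c * r)) := by
    induction L with
    | zero => exact ⟨Fin.elim0, by simp [Real.sqrt_sq hr.le]⟩
    | succ L ih =>
      obtain ⟨z, hz⟩ := ih
      obtain ⟨j, hj⟩ := exists_le_sum_mul (f := fun j =>
        ∑ b, Real.exp (c * Real.sqrt (r ^ 2 + ‖(∑ i, v b (z i)) + v b j‖ ^ 2))) hp hsum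
      refine ⟨Fin.snoc z j, ?_⟩
      simp only [Fin.sum_univ_castSucc, Fin.snoc_castSucc, Fin.snoc_last]
      refine hj.trans ?_
      calc _ = ∑ b, ∑ j, p j *
            Real.exp (c * Real.sqrt (r ^ 2 + ‖(∑ i, v b (z i)) + v b j‖ ^ 2)) := by
            rw [Finset.sum_comm]
            simp only [Finset.mul_sum]
        _ ≤ ∑ b, Real.exp δ * Real.exp (c * Real.sqrt (r ^ 2 + ‖∑ i, v b (z i)‖ ^ 2)) :=
            Finset.sum_le_sum fun b _ => sum_mul_exp_sqrt_norm_add_le hp hsum (hmean b) (hM b)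
              (hV b) hV0 hr hc.le hcM _
        _ ≤ Real.exp δ * (Real.exp (L * δ) * (Fintype.card β * Real.exp (c * r))) := by
            rw [← Finset.mul_sum]
            gcongr
        _ = _ := by
            rw [← mul_assoc, ← Real.exp_add]
            push_cast
            ring_nf
  obtain ⟨z, hz⟩ := key
  refine ⟨z, fun b => ?_⟩
  have hcard : (0 : ℝ) < Fintype.card β := by exact_mod_cast Fintype.card_pos
  have h1 : Real.exp (c * ‖∑ i, v b (z i)‖) ≤
      Real.exp (L * δ + Real.log (Fintype.card β) + c * r) := by
    rw [Real.exp_add, Real.exp_add, Real.exp_log hcard, mul_assoc]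
    refine le_trans ?_ ((Finset.single_le_sum (f := fun b =>
      Real.exp (c * Real.sqrt (r ^ 2 + ‖∑ i, v b (z i)‖ ^ 2)))
      (fun _ _ => (Real.exp_pos _).le) (Finset.mem_univ b)).trans hz)
    gcongr
    exact Real.le_sqrt_of_sq_le (by nlinarith [sq_nonneg r])
  have h2 := Real.exp_le_exp.1 h1
  have h3 : Real.log (Fintype.card β) / c + r + L * (M ^ 2 / (2 * r) + c * V) =
      (L * δ + Real.log (Fintype.card β) + c * r) / c := by
    rw [hδ]; field_simp; ring
  rw [h3, le_div_iff₀ hc]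
  linarith

end Greedy

/-! ### Maurey sparsification over the atoms. -/

section Sparsify

/-- The fourth roots of unity. -/
def phase : Fin 4 → ℂ := ![1, -1, Complex.I, -Complex.I]

/-- Half the positive and negative parts of the real and imaginary parts of `z`. -/
def phaseWeight (z : ℂ) : Fin 4 → ℝ :=
  ![max z.re 0 / 2, max (-z.re) 0 / 2, max z.im 0 / 2, max (-z.im) 0 / 2]

theorem norm_phase (i : Fin 4) : ‖phase i‖ = 1 := by
  fin_cases i <;> simp [phase]

theorem phaseWeight_nonneg (z : ℂ) (i : Fin 4) : 0 ≤ phaseWeight z i := by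
  fin_cases i <;> simp [phaseWeight] <;> positivity

theorem max_zero_add_max_neg (a : ℝ) : max a 0 + max (-a) 0 = |a| := by
  rcases le_total 0 a with h | h
  · simp [h, abs_of_nonneg h]
  · simp [h, abs_of_nonpos h]

theorem max_zero_sub_max_neg (a : ℝ) : max a 0 - max (-a) 0 = a := by
  rcases le_total 0 a with h | h
  · simp [h]
  · simp [h]

/-- `|re z| + |im z| ≤ 2‖z‖`: the halved weights absorb this `2`, and the atoms restore it. -/
theorem sum_phaseWeight_le (z : ℂ) : ∑ i, phaseWeight z i ≤ ‖z‖ := by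
  have h1 := max_zero_add_max_neg z.re
  have h2 := max_zero_add_max_neg z.im
  have h3 := Complex.abs_re_le_norm z
  have h4 := Complex.abs_im_le_norm z
  have : ∑ i, phaseWeight z i = max z.re 0 / 2 + max (-z.re) 0 / 2 + max z.im 0 / 2 +
      max (-z.im) 0 / 2 := by
    simp [Fin.sum_univ_four, phaseWeight]
  linarith

theorem sum_phaseWeight_mul (z : ℂ) : ∑ i, (phaseWeight z i : ℂ) * (2 * phase i) = z := by
  have h1 := max_zero_sub_max_neg z.re
  have h2 := max_zero_sub_max_neg z.im
  have : ∑ i, (phaseWeight z i : ℂ) * (2 * phase i) =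
      ((max z.re 0 - max (-z.re) 0 : ℝ) : ℂ) + ((max z.im 0 - max (-z.im) 0 : ℝ) : ℂ) *
        Complex.I := by
    simp only [Fin.sum_univ_four, phaseWeight, phase, Matrix.cons_val]
    push_cast
    ring
  rw [this, h1, h2, Complex.re_add_im]

/-- The origin and the vectors `2 ω e_j`, with `ω` a fourth root of unity. -/
def atom (d : ℕ) : Option (Fin d × Fin 4) → EuclideanSpace ℂ (Fin d)
  | none => 0
  | some (j, i) => EuclideanSpace.single j (2 * phase i)

/-- The weights that represent `x` as a convex combination of atoms. -/
def atomWeight {d : ℕ} (x : EuclideanSpace ℂ (Fin d)) : Option (Fin d × Fin 4) → ℝ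
  | none => 1 - ∑ j, ∑ i, phaseWeight (x j) i
  | some (j, i) => phaseWeight (x j) i

variable {d : ℕ}

theorem atomWeight_nonneg {x : EuclideanSpace ℂ (Fin d)} (hx : ∑ j, ‖x j‖ ≤ 1)
    (a : Option (Fin d × Fin 4)) : 0 ≤ atomWeight x a := by
  rcases a with _ | ⟨j, i⟩
  · have := Finset.sum_le_sum fun j (_ : j ∈ Finset.univ) => sum_phaseWeight_le (x j)
    simp only [atomWeight]
    linarith
  · exact phaseWeight_nonneg _ _

theorem sum_atomWeight (x : EuclideanSpace ℂ (Fin d)) : ∑ a, atomWeight x a = 1 := by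
  rw [Fintype.sum_option, Fintype.sum_prod_type]
  simp [atomWeight]

theorem sum_atomWeight_smul_atom (x : EuclideanSpace ℂ (Fin d)) :
    ∑ a, atomWeight x a • atom d a = x := by
  rw [Fintype.sum_option, Fintype.sum_prod_type]
  simp only [atomWeight, atom, smul_zero, zero_add]
  ext k
  simp only [WithLp.ofLp_sum, Finset.sum_apply, PiLp.smul_apply, PiLp.single_apply,
    smul_ite, smul_zero, Complex.real_smul]
  rw [Finset.sum_eq_single k (fun j _ hj => by simp [hj.symm]) (by simp)]
  simpa using sum_phaseWeight_mul (x k)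

theorem atom_some (j : Fin d) (i : Fin 4) :
    atom d (some (j, i)) = (2 * phase i) • EuclideanSpace.single j (1 : ℂ) := by
  ext k
  simp [atom]

variable {H : Type*} [NormedAddCommGroup H] [InnerProductSpace ℂ H]

theorem map_eq_sum_smul_single (W : EuclideanSpace ℂ (Fin d) →ₗ[ℂ] H)
    (x : EuclideanSpace ℂ (Fin d)) :
    W x = ∑ j, x j • W (EuclideanSpace.single j 1) := by
  have h : x = ∑ j, x j • EuclideanSpace.single j (1 : ℂ) := by
    ext k
    simp [Pi.single_apply]
  conv_lhs => rw [h]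
  simp

theorem norm_map_le_mul_sum {W : EuclideanSpace ℂ (Fin d) →ₗ[ℂ] H} {R : ℝ}
    (hW : ∀ j, ‖W (EuclideanSpace.single j 1)‖ ≤ R) (x : EuclideanSpace ℂ (Fin d)) :
    ‖W x‖ ≤ R * ∑ j, ‖x j‖ := by
  rw [map_eq_sum_smul_single, Finset.mul_sum]
  refine (norm_sum_le _ _).trans (Finset.sum_le_sum fun j _ => ?_)
  rw [norm_smul, mul_comm]
  gcongr
  exact hW j

theorem norm_map_atom_le {W : EuclideanSpace ℂ (Fin d) →ₗ[ℂ] H} {R : ℝ} (hR : 0 ≤ R)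
    (hW : ∀ j, ‖W (EuclideanSpace.single j 1)‖ ≤ R) (a : Option (Fin d × Fin 4)) :
    ‖W (atom d a)‖ ≤ 2 * R := by
  rcases a with _ | ⟨j, i⟩
  · simpa [atom] using hR
  · rw [atom_some, map_smul, norm_smul, norm_mul, norm_phase]
    simpa using hW j

/-- A weighted sum of squares of correlations is controlled by the values of `W` at the vectors
with the same moduli as `x`. -/
theorem sum_norm_mul_norm_inner_sq_le {W : EuclideanSpace ℂ (Fin d) →ₗ[ℂ] H} {R τ : ℝ}
    (hR : 0 ≤ R) (hW : ∀ j, ‖W (EuclideanSpace.single j 1)‖ ≤ R)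
    {x : EuclideanSpace ℂ (Fin d)}
    (hτ : ∀ y : EuclideanSpace ℂ (Fin d), (∀ j, ‖y j‖ = ‖x j‖) → ‖W y‖ ≤ τ) (S : H) :
    ∑ j, ‖x j‖ * ‖inner ℂ S (W (EuclideanSpace.single j 1))‖ ^ 2 ≤ R * τ * ‖S‖ ^ 2 := by
  set c : Fin d → ℂ := fun j => inner ℂ S (W (EuclideanSpace.single j 1)) with hc
  -- Rotating the phases of `x` against those of `c` turns `⟨S, W y⟩` into `∑ ‖x j‖ ‖c j‖`, hence at
  -- most `‖S‖ τ`. The other factor `‖c j‖` is at most `‖S‖ R`.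
  set y : EuclideanSpace ℂ (Fin d) := WithLp.toLp 2 fun j =>
    if c j = 0 then x j else ‖x j‖ * ((starRingEnd ℂ) (c j) / ‖c j‖) with hy
  have hynorm : ∀ j, ‖y j‖ = ‖x j‖ := by
    intro j
    by_cases h : c j = 0
    · simp [hy, h]
    · simp [hy, h]
  have hyc : ∀ j, y j * c j = ((‖x j‖ * ‖c j‖ : ℝ) : ℂ) := by
    intro j
    by_cases h : c j = 0
    · simp [h]
    · have h' : (‖c j‖ : ℂ) ≠ 0 := by simpa using h
      have := Complex.conj_mul' (c j)
      simp only [hy, h, if_false]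
      push_cast
      field_simp
      rw [mul_assoc, this]
  have hinner : inner ℂ S (W y) = ((∑ j, ‖x j‖ * ‖c j‖ : ℝ) : ℂ) := by
    rw [map_eq_sum_smul_single, inner_sum]
    push_cast
    refine Finset.sum_congr rfl fun j _ => ?_
    rw [inner_smul_right]
    exact (hyc j).trans (by push_cast; rfl)
  have hsum0 : 0 ≤ ∑ j, ‖x j‖ * ‖c j‖ := Finset.sum_nonneg fun j _ => by positivity
  have hsum : ∑ j, ‖x j‖ * ‖c j‖ ≤ ‖S‖ * τ := by
    have h1 : ‖(inner ℂ S (W y) : ℂ)‖ ≤ ‖S‖ * ‖W y‖ := norm_inner_le_norm _ _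
    rw [hinner, Complex.norm_real, Real.norm_of_nonneg hsum0] at h1
    exact h1.trans (by gcongr; exact hτ y hynorm)
  have hcR : ∀ j, ‖c j‖ ≤ ‖S‖ * R := fun j =>
    (norm_inner_le_norm _ _).trans (by gcongr; exact hW j)
  calc ∑ j, ‖x j‖ * ‖c j‖ ^ 2 ≤ ∑ j, (‖S‖ * R) * (‖x j‖ * ‖c j‖) := by
        refine Finset.sum_le_sum fun j _ => ?_
        have := mul_le_mul_of_nonneg_left (hcR j)
          (mul_nonneg (norm_nonneg (x j)) (norm_nonneg (c j)))
        nlinarith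
    _ ≤ (‖S‖ * R) * (‖S‖ * τ) := by
        rw [← Finset.mul_sum]
        gcongr
    _ = _ := by ring

theorem sum_atomWeight_mul_inner_sq_le {W : EuclideanSpace ℂ (Fin d) →ₗ[ℂ] H} {R τ : ℝ}
    (hR : 0 ≤ R) (hW : ∀ j, ‖W (EuclideanSpace.single j 1)‖ ≤ R)
    {x : EuclideanSpace ℂ (Fin d)}
    (hτ : ∀ y : EuclideanSpace ℂ (Fin d), (∀ j, ‖y j‖ = ‖x j‖) → ‖W y‖ ≤ τ) (S : H) :
    ∑ a, atomWeight x a * (inner ℂ S (W (atom d a))).re ^ 2 ≤ 4 * R * τ * ‖S‖ ^ 2 := by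
  have hterm : ∀ j i, (inner ℂ S (W (atom d (some (j, i))))).re ^ 2 ≤
      4 * ‖inner ℂ S (W (EuclideanSpace.single j 1))‖ ^ 2 := by
    intro j i
    rw [atom_some, map_smul, inner_smul_right]
    have h1 := Complex.abs_re_le_norm
      (2 * phase i * inner ℂ S (W (EuclideanSpace.single j 1)))
    rw [norm_mul, norm_mul, norm_phase, mul_one, RCLike.norm_ofNat] at h1
    calc _ ≤ (2 * ‖inner ℂ S (W (EuclideanSpace.single j 1))‖) ^ 2 := sq_le_sq' (by
          linarith [(abs_le.1 h1).1]) (abs_le.1 h1).2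
      _ = _ := by ring
  rw [Fintype.sum_option, Fintype.sum_prod_type]
  simp only [atom, map_zero, inner_zero_right, Complex.zero_re, ne_eq, OfNat.ofNat_ne_zero, not_false_eq_true,
    zero_pow, mul_zero, zero_add]
  calc _ ≤ ∑ j, ‖x j‖ * (4 * ‖inner ℂ S (W (EuclideanSpace.single j 1))‖ ^ 2) := by
        refine Finset.sum_le_sum fun j _ => ?_
        calc _ ≤ ∑ i, phaseWeight (x j) i *
              (4 * ‖inner ℂ S (W (EuclideanSpace.single j 1))‖ ^ 2) :=
              Finset.sum_le_sum fun i _ =>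
                mul_le_mul_of_nonneg_left (hterm j i) (phaseWeight_nonneg _ _)
          _ ≤ _ := by
              rw [← Finset.sum_mul]
              gcongr
              exact sum_phaseWeight_le _
    _ = 4 * ∑ j, ‖x j‖ * ‖inner ℂ S (W (EuclideanSpace.single j 1))‖ ^ 2 := by
        rw [Finset.mul_sum]
        exact Finset.sum_congr rfl fun j _ => by ring
    _ ≤ 4 * (R * τ * ‖S‖ ^ 2) := by
        gcongr
        exact sum_norm_mul_norm_inner_sq_le hR hW hτ S
    _ = _ := by ring

/-- Centring lowers a second moment by the square of the mean. -/
theorem sum_mul_inner_sub_sq_le {ι : Type*} [Fintype ι] {E : Type*} [NormedAddCommGroup E]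
    [InnerProductSpace ℂ E] {p : ι → ℝ} (hsum : ∑ a, p a = 1) {v : ι → E} {μ : E}
    (hμ : ∑ a, p a • v a = μ) (S : E) :
    ∑ a, p a * (inner ℂ S (v a - μ)).re ^ 2 ≤ ∑ a, p a * (inner ℂ S (v a)).re ^ 2 := by
  have h1 : ∑ a, p a * (inner ℂ S (v a)).re = (inner ℂ S μ).re := by
    rw [← hμ, inner_sum, Complex.re_sum]
    exact Finset.sum_congr rfl fun a _ => (re_inner_real_smul _ _ _).symm
  have h2 : ∑ a, p a * (inner ℂ S (v a - μ)).re ^ 2 =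
      ∑ a, p a * (inner ℂ S (v a)).re ^ 2 - 2 * (inner ℂ S μ).re * ∑ a, p a * (inner ℂ S (v a)).re +
        (inner ℂ S μ).re ^ 2 * ∑ a, p a := by
    rw [Finset.mul_sum, Finset.mul_sum, ← Finset.sum_sub_distrib, ← Finset.sum_add_distrib]
    refine Finset.sum_congr rfl fun a _ => ?_
    rw [inner_sub_right, Complex.sub_re]; ring
  rw [h2, h1, hsum]
  nlinarith [sq_nonneg ((inner ℂ S μ).re)]

/-- Maurey-type approximation of `x` by an average of `L` atoms, simultaneously under all the
maps `W b`. -/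
theorem exists_norm_map_sub_average_le {β : Type*} [Fintype β] [Nonempty β]
    {W : β → EuclideanSpace ℂ (Fin d) →ₗ[ℂ] H} {R Λ : ℝ} (hR : 0 < R)
    (hW : ∀ b j, ‖W b (EuclideanSpace.single j 1)‖ ≤ R) (hΛ : 1 ≤ Λ)
    (hβ : Real.log (Fintype.card β) ≤ Λ) {x : EuclideanSpace ℂ (Fin d)}
    (hx : ∑ j, ‖x j‖ ≤ 1)
    (hweak : ∀ b, ∀ y : EuclideanSpace ℂ (Fin d), (∀ j, ‖y j‖ = ‖x j‖) →
      Λ * ‖W b y‖ ≤ 2 * R) {L : ℕ} (hL : Λ ^ 2 ≤ L) :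
    ∃ z : Fin L → Option (Fin d × Fin 4), ∀ b,
      ‖W b (x - (L : ℝ)⁻¹ • ∑ i, atom d (z i))‖ ≤ 12 * R / Real.sqrt L := by
  have hΛ0 : 0 < Λ := one_pos.trans_le hΛ
  have hL0 : (0 : ℝ) < L := (by positivity : (0 : ℝ) < Λ ^ 2).trans_le hL
  set q := Real.sqrt L with hq
  have hq0 : 0 < q := Real.sqrt_pos.2 hL0
  have hqq : q ^ 2 = L := Real.sq_sqrt hL0.le
  have hΛq : Λ ≤ q := Real.le_sqrt_of_sq_le hL
  have hmean : ∀ b, ∑ a, atomWeight x a • W b (atom d a) = W b x := by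
    intro b
    conv_rhs => rw [← sum_atomWeight_smul_atom x]
    rw [map_sum]
    exact Finset.sum_congr rfl fun a _ => ((W b).map_smul_of_tower _ _).symm
  have hcent : ∀ b, ∑ a, atomWeight x a • (W b (atom d a) - W b x) = 0 := by
    intro b
    simp only [smul_sub, Finset.sum_sub_distrib, hmean, ← Finset.sum_smul, sum_atomWeight,
      one_smul, sub_self]
  have hbound : ∀ b a, ‖W b (atom d a) - W b x‖ ≤ 4 * R := by
    intro b a
    have h1 := norm_map_atom_le hR.le (hW b) a
    have h2 := norm_map_le_mul_sum (hW b) x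
    have h3 := mul_le_mul_of_nonneg_left hx hR.le
    have := norm_sub_le (W b (atom d a)) (W b x)
    linarith
  have hvar : ∀ b, ∀ S : H, ∑ a, atomWeight x a * (inner ℂ S (W b (atom d a) - W b x)).re ^ 2 ≤
      4 * R * (2 * R / Λ) * ‖S‖ ^ 2 := fun b S =>
    (sum_mul_inner_sub_sq_le (sum_atomWeight x) (hmean b) S).trans
      (sum_atomWeight_mul_inner_sq_le hR.le (hW b)
        (fun y hy => by rw [le_div_iff₀ hΛ0, mul_comm]; exact hweak b y hy) S)
  -- With these `r` and `c`, each of the three contributions to the bound is at most `4R√L`. The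
  -- condition `c * M ≤ 1` becomes `Λ ≤ √L`.
  obtain ⟨z, hz⟩ := exists_norm_sum_le (r := 4 * R * q) (c := Λ / (4 * R * q))
    (atomWeight_nonneg hx) (sum_atomWeight x) hcent hbound hvar (by positivity) (by positivity)
    (by positivity)
    (by rw [div_mul_eq_mul_div, div_le_one (by positivity)]; nlinarith) L
  refine ⟨z, fun b => ?_⟩
  have h1 := hz b
  have h2 : Real.log (Fintype.card β) / (Λ / (4 * R * q)) ≤ 4 * R * q := by
    rw [div_le_iff₀ (by positivity)]
    calc _ ≤ Λ := hβ
      _ = _ := by field_simp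
  have h3 : (L : ℝ) * ((4 * R) ^ 2 / (2 * (4 * R * q)) +
      Λ / (4 * R * q) * (4 * R * (2 * R / Λ))) = 4 * R * q := by
    rw [← hqq]; field_simp; ring
  have h4 : ‖∑ i, (W b (atom d (z i)) - W b x)‖ ≤ 12 * R * q := by linarith
  have h5 : W b (x - (L : ℝ)⁻¹ • ∑ i, atom d (z i)) =
      -((L : ℝ)⁻¹ • ∑ i, (W b (atom d (z i)) - W b x)) := by
    rw [map_sub, (W b).map_smul_of_tower, map_sum, Finset.sum_sub_distrib, smul_sub]
    simp only [Finset.sum_const, Finset.card_univ, Fintype.card_fin]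
    rw [← Nat.cast_smul_eq_nsmul ℝ, inv_smul_smul₀ hL0.ne', neg_sub]
  rw [h5, norm_neg, norm_smul, norm_inv, Real.norm_of_nonneg hL0.le, ← hqq]
  rw [le_div_iff₀ hq0]
  calc _ ≤ (q ^ 2)⁻¹ * (12 * R * q) * q := by gcongr
    _ = _ := by field_simp

end Sparsify

/-! ### Covering numbers from finite nets. -/

section CoveringNumber

variable {E : Type*} [AddCommGroup E] [Module ℂ E]

theorem seminormCoveringNumber_le_one {T : Set E} {p : Seminorm ℂ E} {u : ℝ≥0} (h0 : 0 ∈ T)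
    (h : ∀ x ∈ T, p x ≤ u) : seminormCoveringNumber T p u ≤ 1 := by
  let : SeminormedAddCommGroup E := p.toAddGroupSeminorm.toSeminormedAddCommGroup
  have hC : Metric.IsCover u T {0} := by
    intro x hx
    refine ⟨0, rfl, ?_⟩
    change edist x 0 ≤ u
    rw [edist_nndist]
    norm_cast
    rw [← NNReal.coe_le_coe, coe_nndist, dist_zero_right]
    exact h x hx
  refine (hC.coveringNumber_le_encard (Set.singleton_subset_iff.2 h0)).trans ?_
  simp

/-- The centres `f i` may lie outside `T`; moving them into `T` doubles the radius, hence `u / 2`.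
-/
theorem seminormCoveringNumber_le_card {ι : Type*} [Fintype ι] {T : Set E} {p : Seminorm ℂ E}
    {u : ℝ≥0} (f : ι → E) (h : ∀ x ∈ T, ∃ i, p (x - f i) ≤ u / 2) :
    seminormCoveringNumber T p u ≤ Fintype.card ι := by
  let : SeminormedAddCommGroup E := p.toAddGroupSeminorm.toSeminormedAddCommGroup
  have hC : Metric.IsCover (u / 2) T (Set.range f) := by
    intro x hx
    obtain ⟨i, hi⟩ := h x hx
    refine ⟨f i, Set.mem_range_self i, ?_⟩
    change edist x (f i) ≤ ((u / 2 : ℝ≥0) : ℝ≥0∞)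
    rw [edist_nndist, ENNReal.coe_le_coe, ← NNReal.coe_le_coe, coe_nndist, dist_eq_norm]
    exact hi
  have h1 := (Metric.coveringNumber_two_mul_le_externalCoveringNumber (u / 2) T).trans
    hC.externalCoveringNumber_le_encard
  rw [mul_div_cancel₀ u two_ne_zero] at h1
  refine h1.trans ?_
  rw [← Set.image_univ]
  refine (Set.encard_image_le f _).trans ?_
  simp

end CoveringNumber

/-! ### Geometry of the scaled sparse ball. -/

section ScaledSparseBall

variable {d k : ℕ}

theorem hammingNorm_congr_norm {x y : EuclideanSpace ℂ (Fin d)} (h : ∀ j, ‖y j‖ = ‖x j‖) :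
    hammingNorm (y.ofLp : Fin d → ℂ) = hammingNorm (x.ofLp : Fin d → ℂ) := by
  unfold hammingNorm
  congr 1
  ext j
  simp only [Finset.mem_filter, Finset.mem_univ, true_and]
  rw [← norm_ne_zero_iff, h j, norm_ne_zero_iff]

theorem mem_scaledSparseBall_iff (hk : 0 < k) {x : EuclideanSpace ℂ (Fin d)} :
    x ∈ scaledSparseBall d k ↔ Real.sqrt k • x ∈ sparseBall d k := by
  have hk' : Real.sqrt k ≠ 0 := by positivity
  constructor
  · rintro ⟨y, hy, rfl⟩
    simpa [smul_inv_smul₀ hk'] using hy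
  · intro h
    exact ⟨_, h, inv_smul_smul₀ hk' x⟩

/-- Lets a bucket bound on the whole set serve as the `τ` of the weak variance estimate. -/
theorem mem_scaledSparseBall_of_norm_eq (hk : 0 < k) {x y : EuclideanSpace ℂ (Fin d)}
    (hx : x ∈ scaledSparseBall d k) (h : ∀ j, ‖y j‖ = ‖x j‖) : y ∈ scaledSparseBall d k := by
  rw [mem_scaledSparseBall_iff hk] at hx ⊢
  have h' : ∀ j, ‖(Real.sqrt k • y) j‖ = ‖(Real.sqrt k • x) j‖ := by
    intro j
    simp [h j]
  refine ⟨(hammingNorm_congr_norm h').trans_le hx.1, ?_⟩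
  have := hx.2
  rw [EuclideanSpace.norm_eq] at this ⊢
  simpa only [h'] using this

theorem zero_mem_scaledSparseBall : (0 : EuclideanSpace ℂ (Fin d)) ∈ scaledSparseBall d k :=
  ⟨0, ⟨by simp, by simp⟩, by simp⟩

/-- Cauchy–Schwarz on the support. -/
theorem sum_norm_le_sqrt_of_mem_sparseBall {x : EuclideanSpace ℂ (Fin d)}
    (hx : x ∈ sparseBall d k) : ∑ j, ‖x j‖ ≤ Real.sqrt k := by
  obtain ⟨h1, h2⟩ := hx
  set s : Finset (Fin d) := {j | x j ≠ 0} with hs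
  have hcard : (s.card : ℝ) ≤ k := by exact_mod_cast h1
  have hsum : ∑ j, ‖x j‖ = ∑ j ∈ s, ‖x j‖ := by
    symm
    apply Finset.sum_subset (Finset.subset_univ _)
    intro j _ hj
    simpa [hs] using hj
  rw [hsum]
  apply Real.le_sqrt_of_sq_le
  refine sq_sum_le_card_mul_sum_sq.trans ?_
  have h3 : ∑ j ∈ s, ‖x j‖ ^ 2 ≤ 1 := by
    calc _ ≤ ∑ j, ‖x j‖ ^ 2 :=
          Finset.sum_le_sum_of_subset_of_nonneg (Finset.subset_univ _) fun _ _ _ => by positivity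
      _ = ‖x‖ ^ 2 := (EuclideanSpace.norm_sq_eq x).symm
      _ ≤ 1 := pow_le_one₀ (norm_nonneg _) h2
  calc _ ≤ (k : ℝ) * 1 := by gcongr
    _ = k := mul_one _

theorem sum_norm_le_one_of_mem_scaledSparseBall (hk : 0 < k) {x : EuclideanSpace ℂ (Fin d)}
    (hx : x ∈ scaledSparseBall d k) : ∑ j, ‖x j‖ ≤ 1 := by
  have hk' : 0 < Real.sqrt k := by positivity
  have h := sum_norm_le_sqrt_of_mem_sparseBall ((mem_scaledSparseBall_iff hk).1 hx)
  have h2 : ∑ j, ‖(Real.sqrt k • x) j‖ = Real.sqrt k * ∑ j, ‖x j‖ := by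
    rw [Finset.mul_sum]
    exact Finset.sum_congr rfl fun j _ => by simp [Real.sqrt_nonneg]
  rw [h2] at h
  exact le_of_mul_le_mul_left (by linarith) hk'

end ScaledSparseBall

/-! ### Size of a single bucket. -/

section Buckets

variable {d m B k : ℕ} {A : Matrix (Fin (m * B)) (Fin d) ℂ}

theorem norm_bucket_single_le (hA : ∀ i j, ‖A i j‖ ≤ 1) (b : Fin m) (j : Fin d) :
    ‖Matrix.toEuclideanLin (bucket A b) (EuclideanSpace.single j 1)‖ ≤ Real.sqrt B := by
  rw [EuclideanSpace.norm_eq]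
  apply Real.sqrt_le_sqrt
  calc _ ≤ ∑ _i : Fin B, (1 : ℝ) := by
        refine Finset.sum_le_sum fun i _ => ?_
        have : (Matrix.toEuclideanLin (bucket A b) (EuclideanSpace.single j 1)) i =
            bucket A b i j := by
          simp [Matrix.toLpLin_apply]
        rw [this]
        exact pow_le_one₀ (norm_nonneg _) (hA _ _)
    _ = B := by simp

theorem xSeminorm_le {x : EuclideanSpace ℂ (Fin d)} {t : ℝ} (ht : 0 ≤ t)
    (h : ∀ b, ‖Matrix.toEuclideanLin (bucket A b) x‖ ≤ t) : xSeminorm A x ≤ t := by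
  rw [xSeminorm_apply]
  exact Real.iSup_le h ht

/-- The growth bound at `s = k`, divided by `√k`, is `Q₁√(B/k) + Q₂`. The conditions `Q₁ log m ≤ √k`
and `Q₂ log m ≤ √B` make each term, times `log m`, at most `√B`. -/
theorem log_mul_norm_bucket_le (hk : 0 < k) {l : ℕ → ℝ} {Q₁ Q₂ : ℝ}
    (hgood : GoodBuckets A k l)
    (hl : ∀ s : ℕ, 1 ≤ s → s ≤ 2 * k → l s ≤ Q₁ * Real.sqrt B + Q₂ * Real.sqrt s)
    (hB : Q₂ ^ 2 * Real.log m ^ 2 ≤ B) (hQk : Q₁ ^ 2 * Real.log m ^ 2 ≤ k)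
    {x : EuclideanSpace ℂ (Fin d)} (hx : x ∈ scaledSparseBall d k) (b : Fin m) :
    Real.log m * ‖Matrix.toEuclideanLin (bucket A b) x‖ ≤ 2 * Real.sqrt B := by
  have hk' : 0 < Real.sqrt k := by positivity
  have hlog : 0 ≤ Real.log m := Real.log_natCast_nonneg m
  have h1 := (hgood k hk (by omega) b _ ((mem_scaledSparseBall_iff hk).1 hx)).trans
    (hl k hk (by omega))
  rw [LinearMap.map_smul_of_tower, norm_smul, Real.norm_of_nonneg hk'.le] at h1
  have h2 : Q₁ * Real.log m ≤ Real.sqrt k := Real.le_sqrt_of_sq_le (by rwa [mul_pow])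
  have h3 : Q₂ * Real.log m ≤ Real.sqrt B := Real.le_sqrt_of_sq_le (by rwa [mul_pow])
  refine le_of_mul_le_mul_left ?_ hk'
  calc _ = Real.log m * (Real.sqrt k * ‖Matrix.toEuclideanLin (bucket A b) x‖) := by ring
    _ ≤ Real.log m * (Q₁ * Real.sqrt B + Q₂ * Real.sqrt k) := by gcongr
    _ = (Q₁ * Real.log m) * Real.sqrt B + (Q₂ * Real.log m) * Real.sqrt k := by ring
    _ ≤ Real.sqrt k * Real.sqrt B + Real.sqrt B * Real.sqrt k := by gcongr
    _ = _ := by ring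

end Buckets

end

/-! ### The choice of `L` and the final count. -/

theorem lemma6 :
    ∃ C : ℝ, 0 < C ∧
      ∀ (d m B k : ℕ), 0 < m → 0 < B → 0 < k →
      ∀ (A : Matrix (Fin (m * B)) (Fin d) ℂ) (l : ℕ → ℝ) (Q₁ Q₂ : ℝ),
        GoodBuckets A k l →
        (∀ s : ℕ, 1 ≤ s → s ≤ 2 * k → l s ≤ Q₁ * Real.sqrt B + Q₂ * Real.sqrt s) →
        (∀ i j, ‖A i j‖ ≤ 1) →
        max (Q₂ ^ 2 * Real.log m ^ 2) (Q₁ ^ 2 * Real.log m * Real.log k) ≤ (B : ℝ) →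
        Q₁ ^ 2 * Real.log m ^ 2 ≤ (k : ℝ) →
        ∀ u : ℝ≥0, 0 < u →
          (seminormCoveringNumber (scaledSparseBall d k) (xSeminorm A) u : ℝ≥0∞) ≤
            ENNReal.ofReal ((2 * (d : ℝ) + 1) ^ (C * ((B : ℝ) / (u : ℝ) ^ 2))) := by
  refine ⟨1154, by norm_num, ?_⟩
  intro d m B k hm hB hk A l Q₁ Q₂ hgood hl hA hBQ hkQ u hu
  have hu' : (0 : ℝ) < u := hu
  have hB' : (0 : ℝ) < B := by exact_mod_cast hB
  have hlogm := fun {x} => log_mul_norm_bucket_le (x := x) hk hgood hl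
    ((le_max_left _ _).trans hBQ) hkQ
  have hℓ1 : ∀ x ∈ scaledSparseBall d k, ∀ b,
      ‖Matrix.toEuclideanLin (bucket A b) x‖ ≤ Real.sqrt B := fun x hx b =>
    (norm_map_le_mul_sum (norm_bucket_single_le hA b) x).trans
      (mul_le_of_le_one_right (Real.sqrt_nonneg _)
        (sum_norm_le_one_of_mem_scaledSparseBall hk hx))
  have hbase : (1 : ℝ) ≤ 2 * d + 1 := by
    have : (0 : ℝ) ≤ d := Nat.cast_nonneg d
    linarith
  have htriv : (∀ x ∈ scaledSparseBall d k, ∀ b,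
      ‖Matrix.toEuclideanLin (bucket A b) x‖ ≤ u) →
      (seminormCoveringNumber (scaledSparseBall d k) (xSeminorm A) u : ℝ≥0∞) ≤
        ENNReal.ofReal ((2 * (d : ℝ) + 1) ^ (1154 * ((B : ℝ) / (u : ℝ) ^ 2))) := by
    intro h
    have h1 := seminormCoveringNumber_le_one (p := xSeminorm A) zero_mem_scaledSparseBall
      fun x hx => xSeminorm_le u.2 (h x hx)
    calc _ ≤ ((1 : ℕ∞) : ℝ≥0∞) := by exact_mod_cast h1
      _ = ENNReal.ofReal 1 := by simp
      _ ≤ _ := ENNReal.ofReal_le_ofReal (Real.one_le_rpow hbase (by positivity))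
  -- In this case and the next, `{0}` is already a `u`-net. Otherwise `B/u² ≥ 1` and `log m <
  -- 2√(B/u²)`, which makes `L` large enough for `Λ ^ 2 ≤ L`.
  rcases le_or_gt (Real.sqrt B) u with hBu | hBu
  · exact htriv fun x hx b => (hℓ1 x hx b).trans hBu
  rcases le_or_gt (2 * Real.sqrt B) (Real.log m * u) with hmu | hmu
  · refine htriv fun x hx b => ?_
    have hlog : 0 < Real.log m :=
      pos_of_mul_pos_left ((by positivity : 0 < 2 * Real.sqrt B).trans_le hmu) hu'.le
    exact le_of_mul_le_mul_left ((hlogm hx b).trans hmu) hlog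
  have hBu2 : 1 ≤ (B : ℝ) / (u : ℝ) ^ 2 := by
    rw [le_div_iff₀ (by positivity), one_mul, ← Real.sq_sqrt hB'.le]
    gcongr
  set t := (B : ℝ) / (u : ℝ) ^ 2 with ht
  have hsqrt : Real.sqrt B = Real.sqrt t * u := by
    rw [ht, Real.sqrt_div' _ (by positivity), Real.sqrt_sq hu'.le]
    field_simp
  have hlogt : Real.log m ≤ 2 * Real.sqrt t := by
    rw [hsqrt] at hmu
    exact (lt_of_mul_lt_mul_right (by linarith) hu'.le).le
  have ht1 : 1 ≤ Real.sqrt t := Real.one_le_sqrt.2 hBu2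
  have htt : Real.sqrt t ^ 2 = t := Real.sq_sqrt (by linarith)
  -- `576 = 24²` makes the error `12√B / √L` at most `u / 2`. Rounding up costs at most `t`, since
  -- `t ≥ 1`.
  set L := ⌈576 * t⌉₊ with hL
  have hLge : 576 * t ≤ L := Nat.le_ceil _
  have hLle : (L : ℝ) ≤ 577 * t := by
    have := (Nat.ceil_lt_add_one (by linarith : 0 ≤ 576 * t)).le
    linarith
  have : Nonempty (Fin m) := ⟨⟨0, hm⟩⟩
  have hnet : ∀ x ∈ scaledSparseBall d k, ∃ z : Fin L → Option (Fin d × Fin 4),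
      xSeminorm A (x - (L : ℝ)⁻¹ • ∑ i, atom d (z i)) ≤ u / 2 := by
    intro x hx
    obtain ⟨z, hz⟩ := exists_norm_map_sub_average_le (R := Real.sqrt B)
      (Λ := max 1 (Real.log m)) (L := L) (W := fun b => Matrix.toEuclideanLin (bucket A b))
      (by positivity) (norm_bucket_single_le hA) (le_max_left _ _) (by simp)
      (sum_norm_le_one_of_mem_scaledSparseBall hk hx)
      (fun b y hy => by
        have hy' := mem_scaledSparseBall_of_norm_eq hk hx hy
        rcases max_choice 1 (Real.log m) with h | h <;> rw [h]
        · have := hℓ1 y hy' b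
          linarith [Real.sqrt_nonneg B]
        · exact hlogm hy' b)
      (by
        have : max 1 (Real.log m) ≤ 2 * Real.sqrt t := max_le (by linarith) hlogt
        calc _ ≤ (2 * Real.sqrt t) ^ 2 := by gcongr
          _ ≤ _ := by rw [mul_pow, htt]; linarith)
    refine ⟨z, xSeminorm_le (by positivity) fun b => (hz b).trans ?_⟩
    have hsL : 24 * Real.sqrt t ≤ Real.sqrt L :=
      Real.le_sqrt_of_sq_le (by rw [mul_pow, htt]; linarith)
    rw [div_le_iff₀ (by linarith), hsqrt]
    nlinarith
  have hcov := seminormCoveringNumber_le_card (u := u)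
    (fun z : Fin L → Option (Fin d × Fin 4) => (L : ℝ)⁻¹ • ∑ i, atom d (z i)) hnet
  have hcard : Fintype.card (Fin L → Option (Fin d × Fin 4)) = (4 * d + 1) ^ L := by
    simp [mul_comm]
  rw [hcard] at hcov
  calc _ ≤ (((4 * d + 1) ^ L : ℕ) : ℝ≥0∞) := by exact_mod_cast hcov
    _ = ENNReal.ofReal (((4 * d + 1) ^ L : ℕ) : ℝ) := (ENNReal.ofReal_natCast _).symm
    _ ≤ _ := by
      apply ENNReal.ofReal_le_ofReal
      push_cast
      -- `4d+1 ≤ (2d+1)²` doubles the exponent, and `2 · 577 = 1154` is the constant.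
      calc ((4 * d + 1 : ℝ)) ^ L ≤ ((2 * d + 1 : ℝ) ^ 2) ^ L := by
            gcongr
            nlinarith [sq_nonneg (d : ℝ)]
        _ = (2 * d + 1 : ℝ) ^ ((2 * L : ℕ) : ℝ) := by rw [Real.rpow_natCast, pow_mul]
        _ ≤ _ := by
            apply Real.rpow_le_rpow_of_exponent_le hbase
            push_cast
            linarith
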